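/- For a group $G$ acting on a set $X$, a coloring $c\colon X\to C$ (with $C$ any set) is *almost invariant* if for each $g\in G$ the identity $c(gx)=c(x)$ fails for only finitely many $x\in X$. Two colorings $X\to C$ are *equivalent* if they differ at only finitely many elements of $X$. A *simplification* of $d\colon X\to D$ is a coloring $i\circ d$ with $i\colon D\to C$ a map. For the closed torus, identify the mapping class group with $\mathrm{SL}_2(\mathbb Z)$ and the set $X$ of isotopy classes of unoriented essential simple closed curves with the set of pairs $(p,q)\in\mathbb Z^2$, $\gcd(p,q)=1$, where $(p,q)$ and $(-p,-q)$ are identified, with the usual action of $\mathrm{SL}_2(\mathbb Z)$. Put $S=\begin{pmatrix}0&1\\-1&0\end{pmatrix}$ and $R=\begin{pmatrix}0&-1\\1&1\end{pmatrix}$. Let $T\subset X$ be the infinite binary tree with root $(1,1)$ in which the two successors of a vertex $v=(p,q)$ are $S^{-1}Rv=(p+q,q)$ and $S^{-1}R^2v=(p,p+q)$; the level of a vertex is its distance from the root, so that there are $2^k$ vertices at level $k$. For $k\ge 0$, a *tree coloring of level $k$* is a coloring $d$ of $X$ by a set of $2^k$ colors such that * $d$ maps the vertices of level $k$ bijectively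 onto the set of colors, * every descendant of a vertex of level $k$ has the same color as that vertex, and * $d(Rx)=d(x)$ for all $x\in X$ (the remaining finitely many $R$-orbits are colored arbitrarily). **Proposition.** A coloring $c\colon X\to C$ is almost invariant under $\mathrm{SL}_2(\mathbb Z)$ if and only if there are a $k\ge 0$ and a tree coloring $d$ of level $k$ such that $c$ is equivalent to a simplification of $d$. -/

import Mathlib

open scoped MatrixGroups

/-! ### Colorings of a set with a group action -/

/-- A coloring `c` of a `G`-set is almost invariant if, for each `g : G`, the identity
`c (g • x) = c x` fails for only finitely many `x`. -/
def AlmostInvariant (G : Type*) [Group G] {X : Type*} [MulAction G X] {C : Type*}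
    (c : X → C) : Prop :=
  ∀ g : G, {x : X | c (g • x) ≠ c x}.Finite

/-- Two colorings are equivalent if they differ at only finitely many elements. -/
def ColoringEquiv {X C : Type*} (c c' : X → C) : Prop :=
  {x : X | c x ≠ c' x}.Finite

/-- `c'` is a simplification of `c` if it is obtained from `c` by identifying colors, i.e. by
post-composing `c` with a map of the sets of colors. -/
def IsSimplification {X C C' : Type*} (c' : X → C') (c : X → C) : Prop :=
  ∃ i : C → C', c' = i ∘ c

/-! ### Curves on the closed torus and the action of the mapping class group `SL(2, ℤ)` -/

/-- Pairs `(p, q)` of coprime integers: oriented essential simple closed curves on the torus. -/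
abbrev PrimitivePair : Type := {v : Fin 2 → ℤ // IsCoprime (v 0) (v 1)}

/-- Forgetting the orientation: `(p, q)` is identified with `(-p, -q)`. -/
instance torusCurveSetoid : Setoid PrimitivePair where
  r v w := w.1 = v.1 ∨ w.1 = -v.1
  iseqv :=
    { refl := fun _ => Or.inl rfl
      symm := by
        rintro v w (h | h)
        · exact Or.inl h.symm
        · exact Or.inr (by rw [h, neg_neg])
      trans := by
        rintro u v w (h | h) (h' | h')
        · exact Or.inl (h'.trans h)
        · exact Or.inr (by rw [h', h])
        · exact Or.inr (by rw [h', h])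
        · exact Or.inl (by rw [h', h, neg_neg]) }

/-- The set of unoriented torus knots, i.e. of (isotopy classes of) essential simple closed curves
on the closed torus: pairs `(p, q)` of coprime integers, with `(p, q)` and `(-p, -q)` identified. -/
def TorusCurve : Type := Quotient torusCurveSetoid

namespace TorusCurve

/-- The usual action of `SL(2, ℤ)` on pairs of coprime integers, written as columns. -/
def pairAct (g : SL(2, ℤ)) (v : PrimitivePair) : PrimitivePair :=
  ⟨g.1.mulVec v.1, v.2.mulVecSL g⟩

instance : MulAction SL(2, ℤ) TorusCurve where
  smul g := Quotient.map (pairAct g) (by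
    rintro v w (h | h)
    · exact Or.inl (by simp only [pairAct, h])
    · exact Or.inr (by simp only [pairAct, h, Matrix.mulVec_neg]))
  one_smul x := by
    induction x using Quotient.inductionOn with
    | h v => exact congrArg (Quotient.mk _) (Subtype.ext (by simp [pairAct]))
  mul_smul g h x := by
    induction x using Quotient.inductionOn with
    | h v => exact congrArg (Quotient.mk _) (Subtype.ext (Matrix.mulVec_mulVec v.1 g.1 h.1).symm)

/-- The curve with label `(p, q)`. -/
def ofPair (p q : ℤ) (h : IsCoprime p q) : TorusCurve :=
  Quotient.mk torusCurveSetoid ⟨![p, q], by simpa using h⟩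

/-- The generator `S` of `SL(2, ℤ)`, with `S² = -1`. -/
def S : SL(2, ℤ) := ⟨!![0, 1; -1, 0], by simp [Matrix.det_fin_two]⟩

/-- The generator `R` of `SL(2, ℤ)`, with `R³ = -1`. -/
def R : SL(2, ℤ) := ⟨!![0, -1; 1, 1], by simp [Matrix.det_fin_two]⟩

/-! ### The binary tree of curves -/

/-- The root `(1, 1)` of the binary tree. -/
def root : TorusCurve := ofPair 1 1 isCoprime_one_left

/-- The two successors of a vertex `x` of the tree: the left one (`false`) is `S⁻¹ R x` and the
right one (`true`) is `S⁻¹ R² x`. -/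
def child (b : Bool) (x : TorusCurve) : TorusCurve :=
  if b then (S⁻¹ * R ^ 2) • x else (S⁻¹ * R) • x

/-- The vertex reached from `x` by the sequence `w` of left and right steps (the last entry of `w`
is the first step). As `w` varies this runs through `x` and all its descendants. -/
def descend : List Bool → TorusCurve → TorusCurve
  | [], x => x
  | b :: w, x => child b (descend w x)

/-- The vertices of the tree at level `k`, i.e. at distance `k` from the root. -/
def treeLevel (k : ℕ) : Set TorusCurve :=
  {x | ∃ w : List Bool, w.length = k ∧ x = descend w root}

/-- The tree-based colorings with `2 ^ k` colors: the vertices at level `k` have pairwise different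
colors, and these are all the colors; every descendant of a vertex at level `k` has the color of
that vertex; and the coloring of all curves is completely invariant under `R`. (The finitely many
curves in the `R`-orbits of `(1, 0)` and of the vertices at levels `< k` are thus colored
`R`-invariantly but otherwise arbitrarily.) -/
structure IsTreeColoring (k : ℕ) (d : TorusCurve → Fin (2 ^ k)) : Prop where
  bijOn_level : Set.BijOn d (treeLevel k) Set.univ
  eq_descend : ∀ x ∈ treeLevel k, ∀ w : List Bool, d (descend w x) = d x
  invariant_R : ∀ x : TorusCurve, d (R • x) = d x

end TorusCurve

/-!
The tree consists of the curves `(p, q)` with `p * q > 0`, each reached from the root by exactly one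
sequence of steps (subtractive Euclidean algorithm, `exists_vertex_of_slopeSign_pos` and
`vertex_injective`). The rotation `R` has order three on curves and each of its orbits, except that
of `(1, 0)`, meets the tree in exactly one vertex. So all but finitely many curves have an address,
the sequence of steps leading to the vertex in their `R`-orbit, and for each `k` only finitely many
curves fail to have an address of length at least `k` (`finite_not_address`).

Tree colorings are almost invariant: since `S` and `R` generate `SL(2, ℤ)`, it is enough to look at
`S`. If `x` lies in the `R`-orbit of a vertex `v`, then up to `R`-orbits `S` exchanges `v` with its
parent and `R v`, `R² v` with the two children of `v`, so far down the tree the color is preserved.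

Conversely, if `c` is almost invariant, then for `k` large `c` is constant on the `R`-orbits of the
vertices at levels at least `k` and unchanged by passing from such a vertex to a child. Hence it
agrees, up to finitely many curves, with a simplification of the tree coloring that records the
first `k` steps of the address.
-/

/-! ### Almost invariant colorings -/

section AlmostInvariant

variable {G X C D : Type*} [Group G] [MulAction G X]

/-- The elements almost fixing a coloring form a subgroup, so almost invariance can be checked on
generators. -/
theorem AlmostInvariant.of_closure_eq_top {c : X → C} {s : Set G} (hs : Subgroup.closure s = ⊤)
    (h : ∀ g ∈ s, {x : X | c (g • x) ≠ c x}.Finite) : AlmostInvariant G c := by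
  intro g
  have hg : g ∈ Subgroup.closure s := hs ▸ Subgroup.mem_top g
  induction hg using Subgroup.closure_induction with
  | mem g hg => exact h g hg
  | one => simp
  | mul a b _ _ ha hb =>
    refine ((ha.preimage (MulAction.injective b).injOn).union hb).subset fun x hx => ?_
    by_contra hn
    simp only [Set.mem_union, Set.mem_preimage, Set.mem_ofPred_eq, not_or, not_not] at hn
    exact hx (by rw [mul_smul, hn.1, hn.2])
  | inv a _ ha =>
    refine (ha.preimage (MulAction.injective a⁻¹).injOn).subset fun x hx => ?_
    simpa using Ne.symm hx

theorem AlmostInvariant.comp {c : X → C} (h : AlmostInvariant G c) (i : C → D) :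
    AlmostInvariant G (i ∘ c) :=
  fun g => (h g).subset fun _ hx hc => hx (congrArg i hc)

theorem AlmostInvariant.of_coloringEquiv {c c' : X → C} (h : AlmostInvariant G c')
    (hc : ColoringEquiv c c') : AlmostInvariant G c := by
  intro g
  refine (((h g).union hc).union
    (Set.Finite.preimage (MulAction.injective g).injOn hc)).subset fun x hx => ?_
  by_contra hn
  simp only [Set.mem_union, Set.mem_preimage, Set.mem_ofPred_eq, not_or, not_not] at hn
  exact hx (by rw [hn.2, hn.1.1, hn.1.2])

end AlmostInvariant

namespace TorusCurve

/-! ### The generators `S` and `R` -/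

theorem closure_S_R : Subgroup.closure {S, R} = ⊤ := by
  rw [eq_top_iff, ← SpecialLinearGroup.SL2Z_generators, Subgroup.closure_le]
  have hS : S ∈ Subgroup.closure {S, R} := Subgroup.subset_closure (by simp)
  have hR : R ∈ Subgroup.closure {S, R} := Subgroup.subset_closure (by simp)
  rintro g (rfl | rfl)
  · have : ModularGroup.S = S⁻¹ := by decide
    rw [this]
    exact inv_mem hS
  · have : ModularGroup.T = S * R := by decide
    rw [this]
    exact mul_mem hS hR

theorem neg_one_smul (x : TorusCurve) : (-1 : SL(2, ℤ)) • x = x := by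
  induction x using Quotient.inductionOn with
  | h v =>
    refine Quotient.sound (Or.inr (funext fun i => ?_))
    fin_cases i <;> simp [pairAct]

theorem R_smul_R_smul_R_smul (x : TorusCurve) : R • R • R • x = x := by
  have : R * (R * R) = -1 := by decide
  rw [← mul_smul, ← mul_smul, mul_assoc, this, neg_one_smul]

theorem S_smul (x : TorusCurve) : S • x = S⁻¹ • x := by
  have : S = S⁻¹ * -1 := by decide
  conv_lhs => rw [this, mul_smul, neg_one_smul]

theorem child_false (x : TorusCurve) : child false x = S • R • x := by
  simp [child, mul_smul, S_smul]

theorem child_true (x : TorusCurve) : child true x = S • R • R • x := by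
  simp [child, mul_smul, S_smul, pow_two]

theorem S_smul_S_smul (x : TorusCurve) : S • S • x = x := by
  rw [S_smul, inv_smul_smul]

theorem child_injective (b : Bool) : Function.Injective (child b) := by
  cases b
  · exact MulAction.injective (S⁻¹ * R)
  · exact MulAction.injective (S⁻¹ * R ^ 2)

theorem ofPair_surjective (x : TorusCurve) : ∃ p q h, x = ofPair p q h := by
  induction x using Quotient.inductionOn with
  | h v =>
    refine ⟨v.1 0, v.1 1, v.2, congrArg (Quotient.mk torusCurveSetoid) (Subtype.ext ?_)⟩
    funext i
    fin_cases i <;> rfl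

theorem ofPair_neg (p q : ℤ) (h : IsCoprime p q) : ofPair (-p) (-q) h.neg_neg = ofPair p q h :=
  Quotient.sound (Or.inr (by simp))

theorem isCoprime_R {p q : ℤ} (h : IsCoprime p q) : IsCoprime (-q) (p + q) := by
  simpa [add_comm] using (h.symm.add_mul_left_right 1).neg_left

theorem R_smul_ofPair (p q : ℤ) (h : IsCoprime p q) :
    R • ofPair p q h = ofPair (-q) (p + q) (isCoprime_R h) := by
  refine Quotient.sound (Or.inl (funext fun i => ?_))
  fin_cases i <;> simp [pairAct, R]

theorem child_false_ofPair (p q : ℤ) (h : IsCoprime p q) (h' : IsCoprime (p + q) q) :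
    child false (ofPair p q h) = ofPair (p + q) q h' := by
  rw [child_false, R_smul_ofPair]
  refine Quotient.sound (Or.inl (funext fun i => ?_))
  fin_cases i <;> simp [pairAct, S]

theorem child_true_ofPair (p q : ℤ) (h : IsCoprime p q) (h' : IsCoprime p (p + q)) :
    child true (ofPair p q h) = ofPair p (p + q) h' := by
  rw [child_true, R_smul_ofPair, R_smul_ofPair]
  refine Quotient.sound (Or.inl (funext fun i => ?_))
  fin_cases i <;> simp [pairAct, S]

/-! ### Two invariants of curves -/

/-- The product `p * q` for the curve `(p, q)`, whose sign is the sign of the slope. -/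
def slopeSign : TorusCurve → ℤ :=
  Quotient.lift (fun v => v.1 0 * v.1 1) (by rintro v w (h | h) <;> simp [h])

/-- The difference `p² - q²` for the curve `(p, q)`. On the tree it is positive at left children,
negative at right children, and zero at the root. -/
def squareDiff : TorusCurve → ℤ :=
  Quotient.lift (fun v => v.1 0 ^ 2 - v.1 1 ^ 2) (by rintro v w (h | h) <;> simp [h])

theorem slopeSign_ofPair (p q : ℤ) (h : IsCoprime p q) : slopeSign (ofPair p q h) = p * q := rfl

theorem squareDiff_ofPair (p q : ℤ) (h : IsCoprime p q) :
    squareDiff (ofPair p q h) = p ^ 2 - q ^ 2 := rfl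

/-- An `R`-orbit contains at most one curve of positive slope. -/
theorem slopeSign_R_smul_nonpos {x : TorusCurve} (hx : 0 < slopeSign x) :
    slopeSign (R • x) ≤ 0 := by
  obtain ⟨p, q, h, rfl⟩ := ofPair_surjective x
  rw [R_smul_ofPair, slopeSign_ofPair]
  rw [slopeSign_ofPair] at hx
  nlinarith [sq_nonneg q]

theorem slopeSign_child_pos (b : Bool) {x : TorusCurve} (hx : 0 < slopeSign x) :
    0 < slopeSign (child b x) := by
  obtain ⟨p, q, h, rfl⟩ := ofPair_surjective x
  rw [slopeSign_ofPair] at hx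
  cases b
  · rw [child_false_ofPair p q h (by simpa using h.add_mul_right_left 1), slopeSign_ofPair]
    nlinarith [sq_nonneg q]
  · rw [child_true_ofPair p q h (by simpa [add_comm] using h.add_mul_left_right 1),
      slopeSign_ofPair]
    nlinarith [sq_nonneg p]

theorem squareDiff_child_false {x : TorusCurve} (hx : 0 < slopeSign x) :
    0 < squareDiff (child false x) := by
  obtain ⟨p, q, h, rfl⟩ := ofPair_surjective x
  rw [slopeSign_ofPair] at hx
  rw [child_false_ofPair p q h (by simpa using h.add_mul_right_left 1), squareDiff_ofPair]
  nlinarith [sq_nonneg p]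

theorem squareDiff_child_true {x : TorusCurve} (hx : 0 < slopeSign x) :
    squareDiff (child true x) < 0 := by
  obtain ⟨p, q, h, rfl⟩ := ofPair_surjective x
  rw [slopeSign_ofPair] at hx
  rw [child_true_ofPair p q h (by simpa [add_comm] using h.add_mul_left_right 1),
    squareDiff_ofPair]
  nlinarith [sq_nonneg q]

/-! ### The vertices of the tree -/

/-- The vertex of the tree reached from the root by the sequence of steps `w`, the last entry of `w`
being the first step. -/
def vertex (w : List Bool) : TorusCurve := descend w root

theorem vertex_cons (b : Bool) (w : List Bool) : vertex (b :: w) = child b (vertex w) := rfl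

theorem descend_vertex (u w : List Bool) : descend u (vertex w) = vertex (u ++ w) := by
  induction u with
  | nil => rfl
  | cons b u ih => rw [descend, ih, List.cons_append, vertex_cons]

theorem slopeSign_vertex_pos (w : List Bool) : 0 < slopeSign (vertex w) := by
  induction w with
  | nil => exact one_pos
  | cons b w ih => exact slopeSign_child_pos b ih

theorem squareDiff_vertex_nil : squareDiff (vertex []) = 0 := rfl

theorem vertex_injective : Function.Injective vertex := by
  have hf w : 0 < squareDiff (vertex (false :: w)) :=
    squareDiff_child_false (slopeSign_vertex_pos w)
  have ht w : squareDiff (vertex (true :: w)) < 0 :=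
    squareDiff_child_true (slopeSign_vertex_pos w)
  have h0 := squareDiff_vertex_nil
  intro u
  induction u with
  | nil =>
    rintro (_ | ⟨_ | _, w⟩) h
    · rfl
    · linarith [hf w, congrArg squareDiff h]
    · linarith [ht w, congrArg squareDiff h]
  | cons a u ih =>
    rintro (_ | ⟨b, w⟩) h
    · cases a
      · linarith [hf u, congrArg squareDiff h]
      · linarith [ht u, congrArg squareDiff h]
    · obtain rfl : a = b := by
        cases a <;> cases b
        · rfl
        · linarith [hf u, ht w, congrArg squareDiff h]
        · linarith [ht u, hf w, congrArg squareDiff h]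
        · rfl
      rw [ih (child_injective a h)]

/-- The Euclidean algorithm by subtraction leads from a positive coprime pair back to the root; `n`
is a bound for the induction. -/
theorem exists_vertex_of_pos (n : ℕ) (p q : ℤ) (hp : 0 < p) (hq : 0 < q) (hn : p + q ≤ n)
    (h : IsCoprime p q) : ∃ w, ofPair p q h = vertex w := by
  induction n generalizing p q with
  | zero => push_cast at hn; omega
  | succ n ih =>
    rcases lt_trichotomy p q with hlt | rfl | hlt
    · have h' : IsCoprime p (q - p) := by
        simpa [sub_eq_add_neg] using h.add_mul_left_right (-1)
      obtain ⟨w, hw⟩ := ih p (q - p) hp (by omega) (by push_cast at hn; omega) h'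
      refine ⟨true :: w, ?_⟩
      rw [vertex_cons, ← hw, child_true_ofPair p (q - p) h' (by simpa using h)]
      congr 1
      omega
    · obtain rfl : p = 1 := by
        have := Int.isUnit_iff.mp (isCoprime_self.mp h)
        omega
      exact ⟨[], rfl⟩
    · have h' : IsCoprime (p - q) q := by
        simpa [sub_eq_add_neg] using h.add_mul_right_left (-1)
      obtain ⟨w, hw⟩ := ih (p - q) q (by omega) hq (by push_cast at hn; omega) h'
      refine ⟨false :: w, ?_⟩
      rw [vertex_cons, ← hw, child_false_ofPair (p - q) q h' (by simpa using h)]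
      congr 1
      omega

theorem exists_vertex_of_slopeSign_pos {x : TorusCurve} (hx : 0 < slopeSign x) :
    ∃ w, x = vertex w := by
  obtain ⟨p, q, h, rfl⟩ := ofPair_surjective x
  rw [slopeSign_ofPair] at hx
  rcases mul_pos_iff.mp hx with ⟨hp, hq⟩ | ⟨hp, hq⟩
  · exact exists_vertex_of_pos (p + q).toNat p q hp hq (by omega) h
  · rw [← ofPair_neg]
    exact exists_vertex_of_pos (-p + -q).toNat (-p) (-q) (by omega) (by omega) (by omega) _

/-! ### Addresses of curves -/

/-- `w` is an address of the curve `x` if the vertex with address `w` lies in the `R`-orbit of `x`,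
which has the elements `x`, `R x`, `R² x`. -/
def IsAddress (w : List Bool) (x : TorusCurve) : Prop :=
  x = vertex w ∨ R • x = vertex w ∨ R • R • x = vertex w

theorem isAddress_vertex (w : List Bool) : IsAddress w (vertex w) := Or.inl rfl

theorem isAddress_R_smul {w : List Bool} {x : TorusCurve} :
    IsAddress w (R • x) ↔ IsAddress w x := by
  simp only [IsAddress, R_smul_R_smul_R_smul]
  tauto

theorem IsAddress.unique {u w : List Bool} {x : TorusCurve} (hu : IsAddress u x)
    (hw : IsAddress w x) : u = w := by
  have h0 := slopeSign_R_smul_nonpos (x := x)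
  have h1 := slopeSign_R_smul_nonpos (x := R • x)
  have h2 := slopeSign_R_smul_nonpos (x := R • R • x)
  rw [R_smul_R_smul_R_smul] at h2
  have pu := slopeSign_vertex_pos u
  have pw := slopeSign_vertex_pos w
  apply vertex_injective
  rcases hu with hu | hu | hu <;> rcases hw with hw | hw | hw <;>
    first
    | exact hu.symm.trans hw
    | (rw [← hu] at pu; rw [← hw] at pw; omega)

theorem finite_not_exists_isAddress : {x : TorusCurve | ¬ ∃ w, IsAddress w x}.Finite := by
  have hfin : ({v : PrimitivePair | v.1 ∈ Set.Icc (-1) 1}).Finite :=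
    (Set.finite_Icc _ _).preimage Subtype.val_injective.injOn
  refine (hfin.image (Quotient.mk torusCurveSetoid)).subset fun x hx => ?_
  obtain ⟨p, q, h, rfl⟩ := ofPair_surjective x
  have h0 : p * q ≤ 0 := by
    by_contra! hc
    obtain ⟨w, hw⟩ := exists_vertex_of_slopeSign_pos (x := ofPair p q h) hc
    exact hx ⟨w, Or.inl hw⟩
  have h1 : -q * (p + q) ≤ 0 := by
    by_contra! hc
    obtain ⟨w, hw⟩ := exists_vertex_of_slopeSign_pos (x := R • ofPair p q h)
      (by rwa [R_smul_ofPair])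
    exact hx ⟨w, Or.inr (Or.inl hw)⟩
  have h2 : -(p + q) * (-q + (p + q)) ≤ 0 := by
    by_contra! hc
    obtain ⟨w, hw⟩ := exists_vertex_of_slopeSign_pos (x := R • R • ofPair p q h)
      (by rwa [R_smul_ofPair, R_smul_ofPair])
    exact hx ⟨w, Or.inr (Or.inr hw)⟩
  have hpq : (-1 ≤ p ∧ p ≤ 1) ∧ (-1 ≤ q ∧ q ≤ 1) := by
    rcases eq_or_ne p 0 with rfl | hp
    · have := Int.isUnit_iff.mp (isCoprime_zero_left.mp h)
      omega
    rcases eq_or_ne q 0 with rfl | hq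
    · have := Int.isUnit_iff.mp (isCoprime_zero_right.mp h)
      omega
    -- `p` and `q` have opposite signs, while `p + q` has the (weak) sign of each of them.
    have hq' : q = -p := by
      rcases lt_or_gt_of_ne hp with hp | hp <;> rcases lt_or_gt_of_ne hq with hq | hq <;> nlinarith
    subst hq'
    have := Int.isUnit_iff.mp (isCoprime_self.mp (IsCoprime.neg_right_iff _ _ |>.mp h))
    omega
  refine ⟨_, ?_, rfl⟩
  simp only [Set.mem_ofPred_eq, Set.mem_Icc, Pi.le_def, Fin.forall_fin_two]
  exact ⟨⟨hpq.1.1, hpq.2.1⟩, ⟨hpq.1.2, hpq.2.2⟩⟩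

theorem finite_isAddress (w : List Bool) : {x : TorusCurve | IsAddress w x}.Finite := by
  refine (Set.toFinite {vertex w, R • vertex w, R • R • vertex w}).subset ?_
  rintro x (h | h | h)
  · simp [h]
  · simp [← h, R_smul_R_smul_R_smul]
  · simp [← h, R_smul_R_smul_R_smul]

/-- All but finitely many curves have an address of length at least `k`. -/
theorem finite_not_address (k : ℕ) :
    {x : TorusCurve | ¬ ∃ w, IsAddress w x ∧ k ≤ w.length}.Finite := by
  refine (finite_not_exists_isAddress.union ((List.finite_length_lt Bool k).biUnion
    fun w _ => finite_isAddress w)).subset fun x hx => ?_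
  by_cases h : ∃ w, IsAddress w x
  · obtain ⟨w, hw⟩ := h
    refine Or.inr (Set.mem_biUnion (x := w) ?_ hw)
    by_contra hk
    exact hx ⟨w, hw, not_lt.mp hk⟩
  · exact Or.inl h

/-- Exceptions at finitely many curves do not occur far down the tree. -/
theorem exists_forall_address_notMem {E : Set TorusCurve} (hE : E.Finite) :
    ∃ k, ∀ w x, IsAddress w x → k ≤ w.length → x ∉ E := by
  induction E, hE using Set.Finite.induction_on with
  | empty => exact ⟨0, by simp⟩
  | @insert a E _ _ ih =>
    obtain ⟨k, hk⟩ := ih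
    by_cases h : ∃ u, IsAddress u a
    · obtain ⟨u, hu⟩ := h
      refine ⟨max k (u.length + 1), fun w x hw hl => ?_⟩
      rintro (rfl | hx)
      · have := congrArg List.length (hu.unique hw)
        omega
      · exact hk w x hw (le_trans (le_max_left _ _) hl) hx
    · refine ⟨k, fun w x hw hl => ?_⟩
      rintro (rfl | hx)
      · exact h ⟨w, hw⟩
      · exact hk w x hw hl hx

/-! ### Tree colorings are almost invariant -/

theorem IsTreeColoring.apply_of_isAddress {k : ℕ} {d : TorusCurve → Fin (2 ^ k)}
    (hd : IsTreeColoring k d) {w : List Bool} {x : TorusCurve} (hw : IsAddress w x) :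
    d x = d (vertex w) := by
  rcases hw with h | h | h <;> simp [← h, hd.invariant_R]

/-- From level `k` on, children inherit the color of their parent. -/
theorem IsTreeColoring.apply_child {k : ℕ} {d : TorusCurve → Fin (2 ^ k)}
    (hd : IsTreeColoring k d) (b : Bool) {w : List Bool} (hw : k ≤ w.length) :
    d (child b (vertex w)) = d (vertex w) := by
  have hmem : vertex (w.drop (w.length - k)) ∈ treeLevel k := ⟨_, by simp; omega, rfl⟩
  have key u : d (vertex (u ++ w.drop (w.length - k))) = d (vertex (w.drop (w.length - k))) := by
    rw [← descend_vertex]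
    exact hd.eq_descend _ hmem u
  have h1 := key (w.take (w.length - k))
  have h2 := key (b :: w.take (w.length - k))
  rw [List.cons_append] at h2
  rw [List.take_append_drop] at h1 h2
  rw [← vertex_cons, h1, h2]

theorem IsTreeColoring.almostInvariant {k : ℕ} {d : TorusCurve → Fin (2 ^ k)}
    (hd : IsTreeColoring k d) : AlmostInvariant SL(2, ℤ) d := by
  refine AlmostInvariant.of_closure_eq_top closure_S_R ?_
  rintro g (rfl | rfl)
  · refine (finite_not_address (k + 1)).subset fun x hx => ?_
    rintro ⟨_ | ⟨b, w⟩, hw, hl⟩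
    · simp at hl
    rw [List.length_cons, Nat.add_le_add_iff_right] at hl
    refine hx ?_
    rw [hd.apply_of_isAddress hw]
    have hl' : k ≤ (b :: w).length := by rw [List.length_cons]; omega
    rcases hw with h | h | h
    -- `x` is the vertex itself: `S` moves it to the `R`-orbit of its parent.
    · rw [h, vertex_cons, hd.apply_child b hl]
      cases b
      · rw [child_false, S_smul_S_smul, hd.invariant_R]
      · rw [child_true, S_smul_S_smul, hd.invariant_R, hd.invariant_R]
    -- Otherwise `S` moves `x` to a child of the vertex.
    · rw [← hd.apply_child true hl', ← h, child_true, R_smul_R_smul_R_smul]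
    · rw [← hd.apply_child false hl', ← h, child_false, R_smul_R_smul_R_smul]
  · simp [hd.invariant_R]

/-! ### Coloring by the first steps of the address -/

/-- A numbering of the sequences of `k` steps. -/
noncomputable def stepsEquiv (k : ℕ) : List.Vector Bool k ≃ Fin (2 ^ k) :=
  Fintype.equivFinOfCardEq (by simp)

/-- The sequence of the first `k` steps of `w`, that is, the last `k` entries of `w`. -/
def firstSteps (k : ℕ) (w : List Bool) (h : k ≤ w.length) : List.Vector Bool k :=
  ⟨w.drop (w.length - k), by simp; omega⟩

open Classical in
/-- The coloring by the first `k` steps of the address. The finitely many curves without an address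
of length at least `k` get the color `0`. -/
noncomputable def stepColoring (k : ℕ) (x : TorusCurve) : Fin (2 ^ k) :=
  if h : ∃ w, IsAddress w x ∧ k ≤ w.length then
    stepsEquiv k (firstSteps k h.choose h.choose_spec.2)
  else 0

theorem stepColoring_of_isAddress {k : ℕ} {w : List Bool} {x : TorusCurve} (hw : IsAddress w x)
    (hk : k ≤ w.length) : stepColoring k x = stepsEquiv k (firstSteps k w hk) := by
  have h : ∃ w, IsAddress w x ∧ k ≤ w.length := ⟨w, hw, hk⟩
  rw [stepColoring, dif_pos h]
  congr 2
  exact h.choose_spec.1.unique hw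

theorem stepColoring_vertex_append {k : ℕ} (u : List Bool) (w : List.Vector Bool k) :
    stepColoring k (vertex (u ++ w.1)) = stepsEquiv k w := by
  have hk := w.2
  rw [stepColoring_of_isAddress (isAddress_vertex _) (by simp)]
  congr 1
  refine Subtype.ext ?_
  simp [firstSteps, hk]

theorem isTreeColoring_stepColoring (k : ℕ) : IsTreeColoring k (stepColoring k) where
  bijOn_level := by
    refine ⟨fun _ _ => Set.mem_univ _, ?_, ?_⟩
    · rintro _ ⟨u, hu, rfl⟩ _ ⟨w, hw, rfl⟩ h
      have h' : stepsEquiv k ⟨u, hu⟩ = stepsEquiv k ⟨w, hw⟩ :=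
        (stepColoring_vertex_append [] ⟨u, hu⟩).symm.trans
          (h.trans (stepColoring_vertex_append [] ⟨w, hw⟩))
      have huw : u = w := congrArg Subtype.val ((stepsEquiv k).injective h')
      rw [huw]
    · intro j _
      refine ⟨_, ⟨((stepsEquiv k).symm j).1, ((stepsEquiv k).symm j).2, rfl⟩, ?_⟩
      simpa [vertex] using stepColoring_vertex_append [] ((stepsEquiv k).symm j)
  eq_descend := by
    rintro _ ⟨u, hu, rfl⟩ w
    change stepColoring k (descend w (vertex u)) = stepColoring k (vertex u)
    rw [descend_vertex]
    exact (stepColoring_vertex_append w ⟨u, hu⟩).trans (stepColoring_vertex_append [] ⟨u, hu⟩).symm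
  invariant_R x := by
    by_cases h : ∃ w, IsAddress w x ∧ k ≤ w.length
    · obtain ⟨w, hw, hl⟩ := h
      rw [stepColoring_of_isAddress hw hl,
        stepColoring_of_isAddress (isAddress_R_smul.mpr hw) hl]
    · rw [stepColoring, stepColoring, dif_neg h,
        dif_neg (by simpa only [isAddress_R_smul] using h)]

/-! ### Almost invariant colorings far down the tree -/

/-- Far down the tree, an almost invariant coloring is constant on `R`-orbits and is inherited by
children. -/
theorem exists_stable_level {C : Type*} {c : TorusCurve → C} (hc : AlmostInvariant SL(2, ℤ) c) :
    ∃ k, ∀ w x, IsAddress w x → k ≤ w.length →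
      c x = c (vertex w) ∧ ∀ b, c (child b x) = c x := by
  obtain ⟨k, hk⟩ := exists_forall_address_notMem
    (((hc R).union (hc (R * R))).union ((hc (S⁻¹ * R)).union (hc (S⁻¹ * R ^ 2))))
  refine ⟨k, fun w x hw hl => ?_⟩
  have h := hk w x hw hl
  simp only [Set.mem_union, Set.mem_ofPred_eq, not_or, not_not] at h
  obtain ⟨⟨h1, h2⟩, h3, h4⟩ := h
  constructor
  · rcases hw with hw | hw | hw
    · rw [hw]
    · rw [← hw, h1]
    · rw [← hw, ← mul_smul, h2]
  · rintro (_ | _)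
    · exact h3
    · exact h4

theorem exists_stepColoring_equiv {C : Type*} {c : TorusCurve → C}
    (hc : AlmostInvariant SL(2, ℤ) c) :
    ∃ (k : ℕ) (i : Fin (2 ^ k) → C), ColoringEquiv c (i ∘ stepColoring k) := by
  obtain ⟨k, hk⟩ := exists_stable_level hc
  have descent (u w : List Bool) (hw : k ≤ w.length) : c (vertex (u ++ w)) = c (vertex w) := by
    induction u with
    | nil => rfl
    | cons b u ih =>
      rw [List.cons_append, vertex_cons, ← ih]
      exact (hk (u ++ w) _ (isAddress_vertex _) (by simp; omega)).2 b
  refine ⟨k, fun j => c (vertex ((stepsEquiv k).symm j).1),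
    (finite_not_address k).subset fun x hx => ?_⟩
  rintro ⟨w, hw, hl⟩
  refine hx ?_
  rw [Function.comp_apply, stepColoring_of_isAddress hw hl, Equiv.symm_apply_apply,
    (hk w x hw hl).1]
  have := descent (w.take (w.length - k)) (w.drop (w.length - k)) (by simp; omega)
  rwa [List.take_append_drop] at this

end TorusCurve

theorem mainTheorem3 {C : Type*} (c : TorusCurve → C) :
    AlmostInvariant SL(2, ℤ) c ↔
      ∃ (k : ℕ) (d : TorusCurve → Fin (2 ^ k)) (c' : TorusCurve → C),
        TorusCurve.IsTreeColoring k d ∧ IsSimplification c' d ∧ ColoringEquiv c c' := by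
  constructor
  · intro hc
    obtain ⟨k, i, h⟩ := TorusCurve.exists_stepColoring_equiv hc
    exact ⟨k, _, _, TorusCurve.isTreeColoring_stepColoring k, ⟨i, rfl⟩, h⟩
  · rintro ⟨k, d, _, hd, ⟨i, rfl⟩, h⟩
    exact (hd.almostInvariant.comp i).of_coloringEquiv h
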